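/- Let $X$ be a completely regular Hausdorff topological space with topology $\mathscr O$, and let $\mathscr B$ be a $\sigma$-algebra on $X$ with $\mathscr O\subseteq\mathscr B$. A \emph{filter in $\mathscr B$} is a non-empty family $\mathscr F\subseteq\mathscr B$ such that for all $F,G\in\mathscr F$ there is a non-empty $H\in\mathscr F$ with $H\subseteq F\cap G$, and such that $B\in\mathscr F$ whenever $B\in\mathscr B$ and $F\subseteq B$ for some $F\in\mathscr F$. An \emph{ultrafilter in $\mathscr B$} is a filter in $\mathscr B$ that is maximal with respect to inclusion; it is \emph{free} if $\bigcap\mathscr F=\emptyset$, and it has the \emph{countable intersection property} if $\bigcap_{n=1}^\infty F_n\neq\emptyset$ for all $F_1,F_2,\ldots\in\mathscr F$. Suppose that every $B\in\mathscr B$ has compact boundary in $X$. If there is no free ultrafilter in $\mathscr B$ with the countable intersection property, then $X$ is realcompact, i.e., homeomorphic to a closed subspace of a product $\mathbb R^I$ for some set $I$. -/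

import Mathlib

universe u

/-- A filter-base in the σ-algebra of `X`: a non-empty family of measurable sets such that any
two members have a non-empty member of the family inside their intersection. -/
def IsMeasFilterBase {X : Type u} [MeasurableSpace X] (A : Set (Set X)) : Prop :=
  A.Nonempty ∧ (∀ B ∈ A, MeasurableSet B) ∧
    ∀ B ∈ A, ∀ C ∈ A, ∃ D ∈ A, D.Nonempty ∧ D ⊆ B ∩ C

/-- A filter in the σ-algebra of `X`: a filter-base that contains every measurable superset of
each of its members. -/
def IsMeasFilter {X : Type u} [MeasurableSpace X] (F : Set (Set X)) : Prop :=
  IsMeasFilterBase F ∧ ∀ A ∈ F, ∀ B : Set X, MeasurableSet B → A ⊆ B → B ∈ F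

/-- An ultrafilter in the σ-algebra of `X`: a filter that is maximal for inclusion. -/
def IsMeasUltrafilter {X : Type u} [MeasurableSpace X] (F : Set (Set X)) : Prop :=
  Maximal IsMeasFilter F

/-- A family of sets is free if its intersection is empty. -/
def IsFreeFamily {X : Type u} (F : Set (Set X)) : Prop :=
  ⋂₀ F = ∅

/-- The countable intersection property: countably many members always have a common point. -/
def HasCIP {X : Type u} (F : Set (Set X)) : Prop :=
  ∀ f : ℕ → Set X, (∀ n, f n ∈ F) → (⋂ n, f n).Nonempty

/-- A space is realcompact if it is homeomorphic to a closed subspace of a product of copies of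
the real line. -/
def IsRealcompact (X : Type u) [TopologicalSpace X] : Prop :=
  ∃ (ι : Type u) (S : Set (ι → ℝ)), IsClosed S ∧ Nonempty (X ≃ₜ S)

open Filter Topology Set

/-! Suppose `p` lies in the closure of the image of `X` but not in the image. Along the trace on `X`
of the neighbourhoods of `p`, every `f : C(X, ℝ)` converges to the finite value `p f`. Testing this
on a reciprocal gives countable intersections; testing it on a function cut off along a compact
boundary shows that the trace decides every measurable set. Its measurable members are then a
forbidden free ultrafilter. -/

/-- The evaluation map of `X` into the product of copies of the line indexed by `C(X, ℝ)`. -/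
def evalReal (X : Type u) [TopologicalSpace X] (x : X) : C(X, ℝ) → ℝ := fun f => f x

theorem continuous_evalReal (X : Type u) [TopologicalSpace X] : Continuous (evalReal X) :=
  continuous_pi fun f => f.continuous

/-- In a completely regular space, a point and a closed set missing it are separated by a
continuous real function with values in the unit interval. -/
theorem exists_continuous_zero_one_of_notMem_isClosed {Y : Type u} [TopologicalSpace Y]
    [CompletelyRegularSpace Y] {K : Set Y} (hK : IsClosed K) {y : Y} (hy : y ∉ K) :
    ∃ f : Y → ℝ, Continuous f ∧ f y = 0 ∧ (∀ z ∈ K, f z = 1) ∧ ∀ z, 0 ≤ f z ∧ f z ≤ 1 := by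
  obtain ⟨f, hf, h0, h1⟩ := CompletelyRegularSpace.completely_regular y K hK hy
  refine ⟨fun z => f z, continuous_subtype_val.comp hf, by simp [h0], fun z hz => ?_,
    fun z => (f z).2⟩
  simp [h1 hz]

theorem isEmbedding_evalReal (X : Type u) [TopologicalSpace X] [T35Space X] :
    IsEmbedding (evalReal X) := by
  have hind : IsInducing (evalReal X) := by
    refine isInducing_iff_nhds.2 fun x => le_antisymm
      ((continuous_evalReal X).tendsto x).le_comap fun U hU => ?_
    obtain ⟨V, hVU, hV, hx⟩ := mem_nhds_iff.1 hU
    obtain ⟨f, hf, h0, h1, -⟩ :=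
      exists_continuous_zero_one_of_notMem_isClosed hV.isClosed_compl (y := x) (by simpa using hx)
    refine ⟨{q | q ⟨f, hf⟩ < 1}, ?_, fun y hy => hVU ?_⟩
    · refine (isOpen_lt (continuous_apply _) continuous_const).mem_nhds ?_
      simp [evalReal, h0]
    · by_contra hyV
      exact (ne_of_lt hy) (h1 y hyV)
  exact hind.isEmbedding

section Trace

variable {X : Type u} [TopologicalSpace X] {p : C(X, ℝ) → ℝ}

theorem tendsto_comap_evalReal (f : C(X, ℝ)) :
    Tendsto f (comap (evalReal X) (𝓝 p)) (𝓝 (p f)) :=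
  ((continuous_apply f).tendsto p).comp tendsto_comap

/-- Countably many traces of neighbourhoods of a point in the closure of the image of `X` have a
common point. -/
theorem nonempty_iInter_of_mem_comap_evalReal [NeBot (comap (evalReal X) (𝓝 p))]
    (B : ℕ → Set X) (hB : ∀ n, B n ∈ comap (evalReal X) (𝓝 p)) : (⋂ n, B n).Nonempty := by
  have hsep : ∀ n, ∃ g : (C(X, ℝ) → ℝ) → ℝ, Continuous g ∧ g p = 0 ∧
      (∀ x, g (evalReal X x) = 0 → x ∈ B n) ∧ ∀ q, 0 ≤ g q ∧ g q ≤ 1 := by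
    intro n
    obtain ⟨U, hU, hUB⟩ := hB n
    obtain ⟨V, hVU, hV, hp⟩ := mem_nhds_iff.1 hU
    obtain ⟨g, hg, h0, h1, hb⟩ :=
      exists_continuous_zero_one_of_notMem_isClosed hV.isClosed_compl (y := p) (by simpa using hp)
    refine ⟨g, hg, h0, fun x hx => hUB (hVU ?_), hb⟩
    by_contra hxV
    exact zero_ne_one (hx.symm.trans (h1 _ hxV))
  choose g hg hgp hgB hgb using hsep
  have hbound : ∀ n q, ‖(1 / 2 : ℝ) ^ n * g n q‖ ≤ (1 / 2 : ℝ) ^ n := by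
    intro n q
    rw [Real.norm_of_nonneg (mul_nonneg (by positivity) (hgb n q).1)]
    exact mul_le_of_le_one_right (by positivity) (hgb n q).2
  -- `G` vanishes at `p`, while a zero of `G` on `X` would lie in every `B n`.
  let G : (C(X, ℝ) → ℝ) → ℝ := fun q => ∑' n, (1 / 2 : ℝ) ^ n * g n q
  have hG : Continuous G :=
    continuous_tsum (fun n => continuous_const.mul (hg n)) summable_geometric_two hbound
  have hGp : G p = 0 := by simp [G, hgp]
  by_contra hempty
  have hne : ∀ x, G (evalReal X x) ≠ 0 := by
    intro x hx
    have hsum : Summable fun n => (1 / 2 : ℝ) ^ n * g n (evalReal X x) :=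
      Summable.of_norm_bounded summable_geometric_two fun n => hbound n _
    have hnn : ∀ n, 0 ≤ (1 / 2 : ℝ) ^ n * g n (evalReal X x) := fun n =>
      mul_nonneg (by positivity) (hgb n _).1
    have hhas : HasSum (fun n => (1 / 2 : ℝ) ^ n * g n (evalReal X x)) 0 :=
      hsum.hasSum_iff.2 hx
    have hzero := (hasSum_zero_iff_of_nonneg hnn).1 hhas
    refine hempty ⟨x, mem_iInter.2 fun n => hgB n x ?_⟩
    have := congrFun hzero n
    simpa using this
  -- The reciprocal must tend to the finite value `p k`, although `G` tends to `0`: the constant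
  -- product `1` would have limit `0`.
  let k : C(X, ℝ) :=
    ⟨fun x => (G (evalReal X x))⁻¹, (hG.comp (continuous_evalReal X)).inv₀ hne⟩
  have hlim : Tendsto (fun x => k x * G (evalReal X x)) (comap (evalReal X) (𝓝 p))
      (𝓝 (p k * G p)) :=
    (tendsto_comap_evalReal k).mul ((hG.tendsto p).comp tendsto_comap)
  have hone : (fun x => k x * G (evalReal X x)) = fun _ => (1 : ℝ) :=
    funext fun x => inv_mul_cancel₀ (hne x)
  rw [hone, hGp, mul_zero] at hlim
  exact one_ne_zero (tendsto_nhds_unique tendsto_const_nhds hlim)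

/-- A set with compact boundary is decided by the trace of the neighbourhoods of a point outside
the image of `X`. -/
theorem mem_or_compl_mem_comap_evalReal (hp : p ∉ range (evalReal X)) {B : Set X}
    (hB : IsCompact (frontier B)) :
    B ∈ comap (evalReal X) (𝓝 p) ∨ Bᶜ ∈ comap (evalReal X) (𝓝 p) := by
  classical
  obtain ⟨g, hg, h0, h1, -⟩ := exists_continuous_zero_one_of_notMem_isClosed
    (hB.image (continuous_evalReal X)).isClosed (y := p)
    (fun h => hp (image_subset_range _ _ h))
  -- The two branches agree on the frontier, where `g` is `1`. Near `p`, `k` is close to `1` on `B`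
  -- and is `0` off `B`, so its single limit `p k` tells which side the trace takes.
  let k : C(X, ℝ) := ⟨fun x => if x ∈ B then 1 - g (evalReal X x) else 0, by
    refine Continuous.if (fun x hx => ?_)
      (continuous_const.sub (hg.comp (continuous_evalReal X))) continuous_const
    rw [h1 _ (mem_image_of_mem _ hx), sub_self]⟩
  have hk := tendsto_comap_evalReal (p := p) k
  by_cases hpk : p k = 0
  · right
    have hlim : Tendsto (fun x => g (evalReal X x)) (comap (evalReal X) (𝓝 p)) (𝓝 0) :=
      h0 ▸ (hg.tendsto p).comp tendsto_comap
    rw [hpk] at hk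
    filter_upwards [hk.eventually_lt_const (u := 1 / 2) (by norm_num),
      hlim.eventually_lt_const (u := 1 / 2) (by norm_num)] with x hx hx' hxB
    have : k x = 1 - g (evalReal X x) := if_pos hxB
    linarith
  · left
    filter_upwards [hk.eventually_ne hpk] with x hx
    by_contra hxB
    exact hx (if_neg hxB)

end Trace

/-- The measurable members of a filter that decides every measurable set form an ultrafilter in
the σ-algebra. -/
theorem isMeasUltrafilter_of_mem_or_compl_mem {X : Type u} [MeasurableSpace X] (L : Filter X)
    [NeBot L] (hL : ∀ B : Set X, MeasurableSet B → B ∈ L ∨ Bᶜ ∈ L) :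
    IsMeasUltrafilter {B : Set X | MeasurableSet B ∧ B ∈ L} := by
  refine ⟨⟨⟨⟨univ, .univ, univ_mem⟩, fun B hB => hB.1, fun B hB C hC => ?_⟩,
    fun A hA B hB hAB => ⟨hB, mem_of_superset hA.2 hAB⟩⟩, fun G hG hle B hB => ?_⟩
  · have hBC := inter_mem hB.2 hC.2
    exact ⟨B ∩ C, ⟨hB.1.inter hC.1, hBC⟩, nonempty_of_mem hBC, Subset.rfl⟩
  · have hBm := hG.1.2.1 B hB
    refine ⟨hBm, (hL B hBm).resolve_right fun hc => ?_⟩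
    obtain ⟨D, -, ⟨x, hx⟩, hD⟩ := hG.1.2.2 B hB Bᶜ (hle ⟨hBm.compl, hc⟩)
    exact (hD hx).2 (hD hx).1

theorem mainTheorem5 {X : Type u} [TopologicalSpace X] [T35Space X]
    [MeasurableSpace X] [OpensMeasurableSpace X]
    (hbd : ∀ B : Set X, MeasurableSet B → IsCompact (frontier B))
    (hfree : ¬ ∃ F : Set (Set X), IsMeasUltrafilter F ∧ IsFreeFamily F ∧ HasCIP F) :
    IsRealcompact X := by
  refine ⟨C(X, ℝ), range (evalReal X), ?_, ⟨(isEmbedding_evalReal X).toHomeomorph⟩⟩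
  refine isClosed_of_closure_subset fun p hp => ?_
  by_contra hpr
  have : NeBot (comap (evalReal X) (𝓝 p)) := by
    rw [comap_neBot_iff_frequently]
    simpa [mem_closure_iff_frequently] using hp
  refine hfree ⟨{B | MeasurableSet B ∧ B ∈ comap (evalReal X) (𝓝 p)},
    isMeasUltrafilter_of_mem_or_compl_mem _ fun B hB =>
      mem_or_compl_mem_comap_evalReal hpr (hbd B hB), ?_, fun f hf =>
      nonempty_iInter_of_mem_comap_evalReal f fun n => (hf n).2⟩
  refine eq_empty_iff_forall_notMem.2 fun x hx => ?_
  have hxp : evalReal X x ≠ p := fun h => hpr ⟨x, h⟩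
  -- Freeness: `p` differs from the image of `x`, so a neighbourhood of `p` avoids that image.
  refine hx {x}ᶜ ⟨isOpen_compl_singleton.measurableSet, {evalReal X x}ᶜ,
    isOpen_compl_singleton.mem_nhds hxp.symm, fun y hy hyx => hy ?_⟩ rfl
  rw [mem_singleton_iff.1 hyx]
  rfl
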